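/- Let $n\ge 1$, $\mathcal V=\{1,\dots,n\}$, $\epsilon>0$ and $x(0)\in(-\infty,\infty)^n$. Consider the noisy Hegselmann–Krause dynamics $$x_i(t+1)=\frac{1}{|\mathcal N_i(x(t))|}\sum_{j\in\mathcal N_i(x(t))}x_j(t)+\xi_i(t+1),\qquad \mathcal N_i(x(t))=\{j\in\mathcal V:\ |x_j(t)-x_i(t)|\le\epsilon\},\qquad i\in\mathcal V,\ t\ge 0,$$ where the noises $\{\xi_i(t)\}_{i\in\mathcal V,\,t\ge1}$ are independent, identically distributed and non-degenerate (i.e. not almost surely constant) real random variables on a probability space $(\Omega,\mathcal F,P)$. Put $$d_{\mathcal V}(t)=\max_{i,j\in\mathcal V}|x_i(t)-x_j(t)|,\qquad d_{\mathcal V}=\limsup_{t\to\infty}d_{\mathcal V}(t)\in[0,\infty],\qquad T=\min\{t\ge 0:\ d_{\mathcal V}(t')\le\epsilon\text{ for all }t'\ge t\},$$ with $T=\infty$ if there is no such $t$. (i) If there exist real constants $\delta_1,\delta_2$ with $\delta_2-\delta_1=\epsilon$ such that $P\{\delta_1\le\xi_1(1)\le\delta_2\}=1$, then almost surely the system reaches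 quasi-synchronization in finite time, i.e. $P\{T<\infty\}=1$. (ii) If $n\ge2$ and $P\{\delta_1\le\xi_1(1)\le\delta_2\}<1$ for all real $\delta_1,\delta_2$ with $\delta_2-\delta_1=\epsilon$, then almost surely the system cannot reach quasi-synchronization, i.e. $P\{d_{\mathcal V}\le\epsilon\}=0$. -/

import Mathlib

open MeasureTheory ProbabilityTheory Filter

noncomputable section

namespace HK

/-- The neighbor set `N_i(x) = {j : |x_j - x_i| ≤ ε}` of agent `i` in the state `x`. -/
def neighbors {n : ℕ} (ε : ℝ) (x : Fin n → ℝ) (i : Fin n) : Finset (Fin n) :=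
  Finset.univ.filter (fun j => |x j - x i| ≤ ε)

/-- The average opinion of the neighbors of agent `i` (for `ε ≥ 0` the neighbor set contains `i`). -/
def localAverage {n : ℕ} (ε : ℝ) (x : Fin n → ℝ) (i : Fin n) : ℝ :=
  (1 / ((neighbors ε x i).card : ℝ)) * ∑ j ∈ neighbors ε x i, x j

/-- The noisy Hegselmann-Krause dynamics on the whole line, started at `x₀`:
`x_i(t+1) = (average of the neighbors of i at time t) + ξ_i(t+1)`.
The value of the noise at time `0` is never used. -/
def state {Ω : Type*} {n : ℕ} (ε : ℝ) (x₀ : Fin n → ℝ) (ξ : Fin n → ℕ → Ω → ℝ) :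
    ℕ → Ω → Fin n → ℝ
  | 0, _ => x₀
  | t + 1, ω => fun i => localAverage ε (state ε x₀ ξ t ω) i + ξ i (t + 1) ω

/-- The diameter `max_{i,j} |x_i - x_j|` of a state (a maximum over a finite set). -/
def diameter {n : ℕ} (x : Fin n → ℝ) : ℝ :=
  ⨆ p : Fin n × Fin n, |x p.1 - x p.2|

/-- `d_V(ω) = limsup_{t → ∞} d_V(t)(ω)`, as an extended real number, so that it may be `+∞`. -/
def limsupDiameter {Ω : Type*} {n : ℕ} (ε : ℝ) (x₀ : Fin n → ℝ) (ξ : Fin n → ℕ → Ω → ℝ)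
    (ω : Ω) : EReal :=
  limsup (fun t : ℕ => ((diameter (state ε x₀ ξ t ω) : ℝ) : EReal)) atTop

/-- `T(ω) = min {t : d_V(t')(ω) ≤ ε for all t' ≥ t}`, equal to `∞` if there is no such `t`. -/
def syncTime {Ω : Type*} {n : ℕ} (ε : ℝ) (x₀ : Fin n → ℝ) (ξ : Fin n → ℕ → Ω → ℝ)
    (ω : Ω) : ℕ∞ :=
  ⨅ t ∈ {t : ℕ | ∀ t' : ℕ, t ≤ t' → diameter (state ε x₀ ξ t' ω) ≤ ε}, (t : ℕ∞)

/-- Almost surely the system reaches quasi-synchronization in finite time: `P{T < ∞} = 1`. -/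
def ReachesQuasiSyncInFiniteTime {Ω : Type*} [MeasurableSpace Ω] (P : Measure Ω) {n : ℕ}
    (ε : ℝ) (x₀ : Fin n → ℝ) (ξ : Fin n → ℕ → Ω → ℝ) : Prop :=
  P {ω | syncTime ε x₀ ξ ω < ⊤} = 1

/-- Almost surely the system cannot reach quasi-synchronization: `P{d_V ≤ ε} = 0`. -/
def CannotReachQuasiSync {Ω : Type*} [MeasurableSpace Ω] (P : Measure Ω) {n : ℕ}
    (ε : ℝ) (x₀ : Fin n → ℝ) (ξ : Fin n → ℕ → Ω → ℝ) : Prop :=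
  P {ω | limsupDiameter ε x₀ ξ ω ≤ (ε : EReal)} = 0

/-- A real random variable is non-degenerate if it is not almost surely constant. -/
def NonDegenerate {Ω : Type*} [MeasurableSpace Ω] (P : Measure Ω) (X : Ω → ℝ) : Prop :=
  ¬ ∃ c : ℝ, ∀ᵐ ω ∂P, X ω = c

end HK

end

/-!
Both parts rest on viewing the process as a Markov chain: the path up to time `t` is independent of
the noise vector at time `t + 1` (`HK.indepFun_path_noise`), whose law is a product measure, so
probabilities can be computed by integrating out one noise vector at a time.

Quasi-synchronization when the noise lives on an interval of length `ε`. The states of diameter at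
most `ε` are then absorbing, so the probability `f x` of ever reaching them from `x` is the increasing
limit of the probabilities of being there at time `t`, and `f` is harmonic
(`HK.limSyncProb_eq_integral`). If `f ≥ c > 0` for all initial states, then `f = 1`, by the inequality
`1 - f ≤ (1 - c) * (1 - f_t)`, which propagates from `t` to `t + 1` (`HK.limSyncProb_eq_one_of_le`).

The lower bound is proved by induction on the number of groups into which the agents are divided, for
groups of diameter at most `R`, with a constant depending on the number of groups and `R` only
(`HK.exists_le_limSyncProb_of_groups`). At the start every agent is a group of its own, with `R = 0`,
which covers all states. If two groups are close, they are merged into one of larger diameter.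
Otherwise the noise steers all groups to diameter at most `ε` in a bounded number of steps, while they
are still far apart: with `a < b` in the support of the noise, members in the lower half of their group
get a noise near `b`, the others a noise near `a` (`HK.exists_steering`). Separated groups of diameter
at most `ε` stay of diameter at most `ε`, and the difference of two group means is a centred random
walk with bounded, non-degenerate steps. By recurrence, shown with a quadratic Lyapunov function, two
groups eventually come within `ε` of each other and are merged
(`HK.le_limSyncProb_of_ordered_groups`).

No quasi-synchronization when no interval of length `ε` carries the noise. The support of the
noise contains `a` and `b` with `b - a > ε`. In every state, of two agents the one with the larger
average receives a noise near `b` and the other a noise near `a` with a probability bounded below,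
so that the next diameter exceeds some `ρ > ε` (`HK.exists_real_step_mem_closeSet_le`). Hence staying
at diameter at most `ρ` from some time on has probability zero.
-/

namespace HK

/-! ### One step of the dynamics -/

/-- One step of the dynamics from the state `x`, driven by the noise vector `η`. -/
noncomputable def step {n : ℕ} (ε : ℝ) (x η : Fin n → ℝ) : Fin n → ℝ :=
  fun i => localAverage ε x i + η i

/-- The states whose opinions pairwise differ by at most `ρ`, i.e. of diameter at most `ρ`. -/
def closeSet (n : ℕ) (ρ : ℝ) : Set (Fin n → ℝ) := {x | ∀ i j, |x i - x j| ≤ ρ}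

/-- Agents carrying the same label under `g` have opinions at most `R` apart. -/
def IsGrouped {n : ℕ} (g : Fin n → Fin n) (R : ℝ) (x : Fin n → ℝ) : Prop :=
  ∀ i j, g i = g j → |x i - x j| ≤ R

/-- Agents carrying different labels under `g` have opinions more than `L` apart. -/
def IsSeparated {n : ℕ} (g : Fin n → Fin n) (L : ℝ) (x : Fin n → ℝ) : Prop :=
  ∀ i j, g i ≠ g j → L < |x i - x j|

/-- The members of the group of agent `i` under the labelling `g`. -/
def group {n : ℕ} (g : Fin n → Fin n) (i : Fin n) : Finset (Fin n) :=
  Finset.univ.filter (fun j => g j = g i)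

section Step

variable {n : ℕ} {ε : ℝ} {g : Fin n → Fin n} {x η : Fin n → ℝ}

lemma neighbors_nonempty (hε : 0 ≤ ε) (x : Fin n → ℝ) (i : Fin n) :
    (neighbors ε x i).Nonempty :=
  ⟨i, by simp [neighbors, hε]⟩

lemma localAverage_mem_Icc (hε : 0 ≤ ε) {m M : ℝ} {i : Fin n}
    (h : ∀ j, |x j - x i| ≤ ε → m ≤ x j ∧ x j ≤ M) :
    m ≤ localAverage ε x i ∧ localAverage ε x i ≤ M := by
  have hc : (0 : ℝ) < (neighbors ε x i).card := by
    exact_mod_cast (neighbors_nonempty hε x i).card_pos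
  have h1 : (neighbors ε x i).card • m ≤ ∑ j ∈ neighbors ε x i, x j :=
    Finset.card_nsmul_le_sum _ _ _ fun j hj => (h j (by simpa [neighbors] using hj)).1
  have h2 : ∑ j ∈ neighbors ε x i, x j ≤ (neighbors ε x i).card • M :=
    Finset.sum_le_card_nsmul _ _ _ fun j hj => (h j (by simpa [neighbors] using hj)).2
  rw [nsmul_eq_mul] at h1 h2
  unfold localAverage
  rw [one_div_mul_eq_div, le_div_iff₀ hc, div_le_iff₀ hc]
  constructor <;> linarith

lemma abs_localAverage_sub_le (hε : 0 ≤ ε) (x : Fin n → ℝ) (i : Fin n) :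
    |localAverage ε x i - x i| ≤ ε := by
  have := localAverage_mem_Icc (x := x) (i := i) (m := x i - ε) (M := x i + ε) hε
    (fun j hj => by rw [abs_le] at hj; constructor <;> linarith)
  rw [abs_le]
  constructor <;> linarith

lemma neighbors_eq_group (hg : IsGrouped g ε x) (hs : IsSeparated g ε x) (i : Fin n) :
    neighbors ε x i = group g i := by
  ext j
  simp only [neighbors, group, Finset.mem_filter, Finset.mem_univ, true_and]
  refine ⟨fun h => ?_, fun h => hg j i h⟩
  by_contra hne
  exact absurd h (not_le.2 (hs j i hne))

lemma localAverage_eq_of_label_eq (hg : IsGrouped g ε x) (hs : IsSeparated g ε x) {i j : Fin n}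
    (hij : g i = g j) : localAverage ε x i = localAverage ε x j := by
  unfold localAverage
  rw [neighbors_eq_group hg hs, neighbors_eq_group hg hs]
  simp only [group, hij]

/-- Separated groups of diameter at most `ε` keep their diameter at most `ε`: all members move to
the same average and then receive noises at most `ε` apart. -/
lemma IsGrouped.step_of_isSeparated (hg : IsGrouped g ε x) (hs : IsSeparated g ε x)
    (hη : ∀ i j, η i - η j ≤ ε) : IsGrouped g ε (step ε x η) := by
  intro i j hij
  unfold step
  rw [localAverage_eq_of_label_eq hg hs hij, abs_le]
  constructor <;> linarith [hη i j, hη j i]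

lemma step_mem_closeSet (hx : x ∈ closeSet n ε) (hη : ∀ i j, η i - η j ≤ ε) :
    step ε x η ∈ closeSet n ε := by
  have hn : ∀ i, neighbors ε x i = Finset.univ := fun i =>
    Finset.filter_true_of_mem fun j _ => hx j i
  intro i j
  simp only [step, localAverage, hn, abs_le]
  constructor <;> linarith [hη i j, hη j i]

/-- In one step each agent moves by at most `ε` besides the noise, so the gap between two groups
shrinks by at most `3 * ε`. -/
lemma IsSeparated.step (hε : 0 ≤ ε) {L : ℝ} (hs : IsSeparated g (L + 3 * ε) x)
    (hη : ∀ i j, η i - η j ≤ ε) : IsSeparated g L (step ε x η) := by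
  intro i j hij
  have h := hs i j hij
  have h1 := abs_le.1 (abs_localAverage_sub_le hε x i)
  have h2 := abs_le.1 (abs_localAverage_sub_le hε x j)
  have h3 := hη i j
  have h4 := hη j i
  unfold HK.step
  rw [lt_abs] at h ⊢
  rcases h with h | h
  · left; linarith
  · right; linarith

/-- A steering pattern which shrinks every group: members whose average lies in the lower half of
their group receive a noise near `b`, the others a noise near `a < b`. -/
lemma exists_steering (hε : 0 ≤ ε) {R r a b : ℝ} (hR : ε ≤ R) (hr : 6 * r ≤ ε)
    (hab : 3 * r ≤ b - a) (hg : IsGrouped g R x) (hs : IsSeparated g ε x) :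
    ∃ s : Fin n → Bool, ∀ η : Fin n → ℝ, (∀ i j, η i - η j ≤ ε) →
      (∀ i, |η i - (if s i then b else a)| ≤ r) →
      IsGrouped g (max ε (R - r)) (HK.step ε x η) := by
  have hlo : ∀ l : Fin n, ∃ m, ∀ j, g j = l → m ≤ x j ∧ x j ≤ m + R := by
    intro l
    rcases (Finset.univ.filter (fun j => g j = l)).eq_empty_or_nonempty with he | hne
    · refine ⟨0, fun j hj => ?_⟩
      have : j ∈ Finset.univ.filter (fun j => g j = l) := by simp [hj]
      simp [he] at this
    · obtain ⟨k, hk, hmin⟩ := Finset.exists_min_image _ x hne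
      simp only [Finset.mem_filter, Finset.mem_univ, true_and] at hk hmin
      refine ⟨x k, fun j hj => ⟨hmin j hj, ?_⟩⟩
      have := (abs_le.1 (hg j k (hj.trans hk.symm))).2
      linarith
  choose lo hlo using hlo
  have hav : ∀ i, lo (g i) ≤ localAverage ε x i ∧ localAverage ε x i ≤ lo (g i) + R := by
    intro i
    refine localAverage_mem_Icc hε fun j hj => hlo _ j ?_
    by_contra hne
    exact absurd hj (not_le.2 (hs j i hne))
  refine ⟨fun i => decide (localAverage ε x i < lo (g i) + R / 2), fun η hη hηs => ?_⟩
  have key : ∀ i j, g i = g j → HK.step ε x η i - HK.step ε x η j ≤ max ε (R - r) := by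
    intro i j hij
    have hi := hav i
    have hj := hav j
    have hi' := abs_le.1 (hηs i)
    have hj' := abs_le.1 (hηs j)
    have hn := hη i j
    rw [hij] at hi
    simp only [decide_eq_true_eq, hij] at hi' hj'
    unfold HK.step
    rw [le_max_iff]
    by_cases ci : localAverage ε x i < lo (g j) + R / 2 <;>
      by_cases cj : localAverage ε x j < lo (g j) + R / 2 <;>
      simp only [ci, cj, if_true, if_false] at hi' hj'
    · right; linarith
    · left; linarith
    · right; linarith
    · right; linarith
  intro i j hij
  rw [abs_le]
  constructor <;> linarith [key i j hij, key j i hij.symm]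

/-- Groups of diameter at most `ε` that are more than `ε` apart are ordered like any two of their
members. -/
lemma lt_sub_of_groups (hg : IsGrouped g ε x) (hs : IsSeparated g ε x) {i₀ j₀ i j : Fin n}
    (hne : g i₀ ≠ g j₀) (hlt : x j₀ < x i₀) (hi : g i = g i₀) (hj : g j = g j₀) :
    ε < x i - x j := by
  have h0 := hs i₀ j₀ hne
  have h1 := hs i j₀ (by rw [hi]; exact hne)
  have h2 := hs i j (by rw [hi, hj]; exact hne)
  have h3 := abs_le.1 (hg i i₀ hi)
  have h4 := abs_le.1 (hg j j₀ hj)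
  rw [lt_abs] at h0 h1 h2
  rcases h0 with h0 | h0 <;> rcases h1 with h1 | h1 <;> rcases h2 with h2 | h2 <;> linarith

/-- The difference between the mean opinions of the groups of `i₀` and `j₀`. -/
noncomputable def meanGap (g : Fin n → Fin n) (i₀ j₀ : Fin n) (x : Fin n → ℝ) : ℝ :=
  (1 / ((group g i₀).card : ℝ)) * ∑ i ∈ group g i₀, x i -
    (1 / ((group g j₀).card : ℝ)) * ∑ i ∈ group g j₀, x i

lemma meanGap_add (g : Fin n → Fin n) (i₀ j₀ : Fin n) (x y : Fin n → ℝ) :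
    meanGap g i₀ j₀ (x + y) = meanGap g i₀ j₀ x + meanGap g i₀ j₀ y := by
  simp only [meanGap, Pi.add_apply, Finset.sum_add_distrib]
  ring

lemma card_group_pos (g : Fin n → Fin n) (i : Fin n) : (0 : ℝ) < (group g i).card := by
  exact_mod_cast Finset.card_pos.2 ⟨i, by simp [group]⟩

lemma mean_group_mem_Icc (g : Fin n → Fin n) {i : Fin n} {m M : ℝ} {y : Fin n → ℝ}
    (h : ∀ j, g j = g i → m ≤ y j ∧ y j ≤ M) :
    m ≤ (1 / ((group g i).card : ℝ)) * ∑ j ∈ group g i, y j ∧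
      (1 / ((group g i).card : ℝ)) * ∑ j ∈ group g i, y j ≤ M := by
  have hc := card_group_pos g i
  have h1 : (group g i).card • m ≤ ∑ j ∈ group g i, y j :=
    Finset.card_nsmul_le_sum _ _ _ fun j hj => (h j (by simpa [group] using hj)).1
  have h2 : ∑ j ∈ group g i, y j ≤ (group g i).card • M :=
    Finset.sum_le_card_nsmul _ _ _ fun j hj => (h j (by simpa [group] using hj)).2
  rw [nsmul_eq_mul] at h1 h2
  rw [one_div_mul_eq_div, le_div_iff₀ hc, div_le_iff₀ hc]
  constructor <;> linarith

/-- As long as the groups are separated and of diameter at most `ε`, the gap between two group means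
performs a random walk. -/
lemma meanGap_step (hg : IsGrouped g ε x) (hs : IsSeparated g ε x) (i₀ j₀ : Fin n) :
    meanGap g i₀ j₀ (step ε x η) = meanGap g i₀ j₀ x + meanGap g i₀ j₀ η := by
  have hav : ∀ i, ∀ j ∈ group g i,
      localAverage ε x j = (1 / ((group g i).card : ℝ)) * ∑ k ∈ group g i, x k := by
    intro i j hj
    rw [localAverage_eq_of_label_eq hg hs (i := j) (j := i) (by simpa [group] using hj),
      localAverage, neighbors_eq_group hg hs]
  have hstep : step ε x η = localAverage ε x + η := rfl
  rw [hstep, meanGap_add]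
  congr 1
  unfold meanGap
  rw [Finset.sum_congr rfl (hav i₀), Finset.sum_congr rfl (hav j₀), Finset.sum_const,
    Finset.sum_const, nsmul_eq_mul, nsmul_eq_mul]
  have h1 := (card_group_pos g i₀).ne'
  have h2 := (card_group_pos g j₀).ne'
  field_simp

/-- The gap between the group means exceeds `ε`, the largest possible change in one step. -/
lemma lt_meanGap (hg : IsGrouped g ε x) (hs : IsSeparated g ε x) {i₀ j₀ : Fin n}
    (hne : g i₀ ≠ g j₀) (hlt : x j₀ < x i₀) : ε < meanGap g i₀ j₀ x := by
  obtain ⟨k, hk, hkmin⟩ := Finset.exists_min_image (group g i₀) x ⟨i₀, by simp [group]⟩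
  obtain ⟨l, hl, hlmax⟩ := Finset.exists_max_image (group g j₀) x ⟨j₀, by simp [group]⟩
  simp only [group, Finset.mem_filter, Finset.mem_univ, true_and] at hk hl hkmin hlmax
  have h := lt_sub_of_groups hg hs hne hlt hk hl
  obtain ⟨K, hK⟩ := (Finset.univ.image x).bddAbove
  obtain ⟨K', hK'⟩ := (Finset.univ.image x).bddBelow
  have hK1 : ∀ j, x j ≤ K := fun j => hK (by simp)
  have hK2 : ∀ j, K' ≤ x j := fun j => hK' (by simp)
  have h1 := (mean_group_mem_Icc g (i := i₀) (y := x) fun j hj => ⟨hkmin j hj, hK1 j⟩).1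
  have h2 := (mean_group_mem_Icc g (i := j₀) (y := x) fun j hj => ⟨hK2 j, hlmax j hj⟩).2
  unfold meanGap
  linarith

lemma abs_meanGap_le (hη : ∀ i j, η i - η j ≤ ε) (g : Fin n → Fin n) (i₀ j₀ : Fin n) :
    |meanGap g i₀ j₀ η| ≤ ε := by
  obtain ⟨k, -, hk⟩ := Finset.exists_min_image Finset.univ η ⟨i₀, Finset.mem_univ _⟩
  have hb : ∀ j, η k ≤ η j ∧ η j ≤ η k + ε := fun j =>
    ⟨hk j (Finset.mem_univ _), by linarith [hη j k]⟩
  have h1 := mean_group_mem_Icc g (i := i₀) (y := η) fun j _ => hb j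
  have h2 := mean_group_mem_Icc g (i := j₀) (y := η) fun j _ => hb j
  unfold meanGap
  rw [abs_le]
  constructor <;> linarith

/-- Order of two separated groups of diameter at most `ε` survives one step. -/
lemma step_lt_step (hg : IsGrouped g ε x) (hs : IsSeparated g ε x) (hη : ∀ i j, η i - η j ≤ ε)
    {i₀ j₀ : Fin n} (hne : g i₀ ≠ g j₀) (hlt : x j₀ < x i₀) :
    step ε x η j₀ < step ε x η i₀ := by
  have h := lt_meanGap hg hs hne hlt
  unfold meanGap at h
  unfold step localAverage
  rw [neighbors_eq_group hg hs, neighbors_eq_group hg hs]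
  linarith [hη j₀ i₀]

lemma continuous_meanGap (g : Fin n → Fin n) (i₀ j₀ : Fin n) : Continuous (meanGap g i₀ j₀) := by
  unfold meanGap
  fun_prop

lemma measurable_localAverage (ε : ℝ) (i : Fin n) :
    Measurable fun x : Fin n → ℝ => localAverage ε x i := by
  have hset : ∀ j, MeasurableSet {x : Fin n → ℝ | |x j - x i| ≤ ε} := fun j =>
    measurableSet_le (by fun_prop) measurable_const
  have h : (fun x : Fin n → ℝ => localAverage ε x i) = fun x =>
      (1 / ∑ j, if |x j - x i| ≤ ε then (1 : ℝ) else 0) *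
        ∑ j, if |x j - x i| ≤ ε then x j else 0 := by
    ext x
    simp [localAverage, neighbors, Finset.sum_filter]
  rw [h]
  refine Measurable.mul (measurable_const.div ?_) ?_
  · exact Finset.measurable_sum _ fun j _ => Measurable.ite (hset j) measurable_const measurable_const
  · exact Finset.measurable_sum _ fun j _ =>
      Measurable.ite (hset j) (measurable_pi_apply j) measurable_const

lemma measurable_step {α : Type*} [MeasurableSpace α] {f h : α → Fin n → ℝ} (hf : Measurable f)
    (hh : Measurable h) (ε : ℝ) : Measurable fun a => step ε (f a) (h a) := by
  refine measurable_pi_lambda _ fun i => ?_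
  have h1 := (measurable_localAverage ε i).comp hf
  have h2 := (measurable_pi_apply i).comp hh
  exact h1.add h2

lemma measurableSet_closeSet (n : ℕ) (ρ : ℝ) : MeasurableSet (closeSet n ρ) := by
  have : closeSet n ρ = ⋂ i, ⋂ j, {x | |x i - x j| ≤ ρ} := by
    ext x
    simp [closeSet]
  rw [this]
  exact MeasurableSet.iInter fun i => MeasurableSet.iInter fun j =>
    measurableSet_le (by fun_prop) measurable_const

lemma diameter_le_iff {ρ : ℝ} (hρ : 0 ≤ ρ) : diameter x ≤ ρ ↔ x ∈ closeSet n ρ := by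
  constructor
  · intro h i j
    exact (le_ciSup (f := fun p : Fin n × Fin n => |x p.1 - x p.2|)
      (Set.finite_range _).bddAbove (i, j)).trans h
  · exact fun h => Real.iSup_le (fun p => h p.1 p.2) hρ

end Step

/-! ### Noise vectors close to a prescribed two-valued pattern -/

/-- Every pattern with values in two points of the support of `μ` is followed by independent
`μ`-distributed noises with a probability bounded below. -/
lemma exists_le_pi_pattern (μ : Measure ℝ) [IsProbabilityMeasure μ] {a b r : ℝ}
    (ha : a ∈ μ.support) (hb : b ∈ μ.support) (hr : 0 < r) (n : ℕ) :
    ∃ q > 0, ∀ s : Fin n → Bool, q ≤ (Measure.pi fun _ : Fin n => μ).real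
      {η | ∀ i, |η i - (if s i then b else a)| ≤ r} := by
  obtain ⟨s₀, hs₀⟩ := Finite.exists_min fun s : Fin n → Bool =>
    (Measure.pi fun _ : Fin n => μ).real {η | ∀ i, |η i - (if s i then b else a)| ≤ r}
  refine ⟨_, ?_, hs₀⟩
  have hset : {η : Fin n → ℝ | ∀ i, |η i - (if s₀ i then b else a)| ≤ r} =
      Set.univ.pi fun i => Metric.closedBall (if s₀ i then b else a) r := by
    ext η
    simp [Real.dist_eq]
  rw [hset, measureReal_def, Measure.pi_pi, ENNReal.toReal_prod]
  refine Finset.prod_pos fun i _ => ENNReal.toReal_pos (ne_of_gt ?_) (measure_ne_top _ _)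
  refine (Measure.mem_support_iff_forall _).1 ?_ _ (Metric.closedBall_mem_nhds _ hr)
  split_ifs <;> assumption

lemma measurableSet_pattern (a b r : ℝ) (s : Fin n → Bool) :
    MeasurableSet {η : Fin n → ℝ | ∀ i, |η i - (if s i then b else a)| ≤ r} := by
  rw [Set.ofPred_forall]
  exact MeasurableSet.iInter fun i => measurableSet_le (by fun_prop) measurable_const

/-- Otherwise the support, which carries `μ`, would lie in an interval of length `d`. -/
lemma exists_mem_support_of_measure_Icc_lt (μ : Measure ℝ) [IsProbabilityMeasure μ] {d : ℝ}
    (h : ∀ c, μ (Set.Icc c (c + d)) < 1) :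
    ∃ a ∈ μ.support, ∃ b ∈ μ.support, d < b - a := by
  by_contra! hcon
  have hne : μ.support.Nonempty := by
    rw [Set.nonempty_iff_ne_empty]
    intro he
    have := Measure.measure_compl_support (μ := μ)
    simp [he] at this
  obtain ⟨p, hp⟩ := hne
  have hbdd : BddBelow μ.support := ⟨p - d, fun a ha => by linarith [hcon a ha p hp]⟩
  refine (h (sInf μ.support)).ne (le_antisymm prob_le_one ?_)
  have hsub : μ.support ⊆ Set.Icc (sInf μ.support) (sInf μ.support + d) := by
    refine fun b hb => ⟨csInf_le hbdd hb, ?_⟩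
    have : b - d ≤ sInf μ.support := le_csInf ⟨p, hp⟩ fun a ha => by linarith [hcon a ha b hb]
    linarith
  have h1 : μ μ.support = 1 := by
    rw [← compl_compl μ.support, prob_compl_eq_one_iff]
    · exact Measure.measure_compl_support
    · exact Measure.isClosed_support.measurableSet.compl
  rw [← h1]
  exact measure_mono hsub

/-! ### The probability of synchronization as a function of the initial state -/

/-- The probability that the chain started at `x` and driven by independent noise vectors of law `ν`
has diameter at most `ε` at time `t`. -/
noncomputable def syncProb {n : ℕ} (ε : ℝ) (ν : Measure (Fin n → ℝ)) : ℕ → (Fin n → ℝ) → ℝ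
  | 0, x => (closeSet n ε).indicator 1 x
  | t + 1, x => ∫ η, syncProb ε ν t (step ε x η) ∂ν

/-- The probability of ever reaching diameter at most `ε` from `x`. It is encoded as the supremum of
the probabilities at fixed times, which is correct when the states of diameter at most `ε` are
absorbing. -/
noncomputable def limSyncProb {n : ℕ} (ε : ℝ) (ν : Measure (Fin n → ℝ)) (x : Fin n → ℝ) : ℝ :=
  ⨆ t, syncProb ε ν t x

section SyncProb

variable {n : ℕ} {ε : ℝ} {ν : Measure (Fin n → ℝ)}

lemma syncProb_nonneg (t : ℕ) (x : Fin n → ℝ) : 0 ≤ syncProb ε ν t x := by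
  induction t generalizing x with
  | zero => exact Set.indicator_nonneg (fun _ _ => zero_le_one) _
  | succ t ih => exact integral_nonneg fun η => ih _

lemma measurable_step_right (ε : ℝ) (x : Fin n → ℝ) : Measurable (step ε x) :=
  measurable_step measurable_const measurable_id ε

variable [IsProbabilityMeasure ν]

lemma measurable_syncProb (t : ℕ) : Measurable (syncProb ε ν t) := by
  induction t with
  | zero => exact measurable_one.indicator (measurableSet_closeSet n ε)
  | succ t ih =>
    exact (StronglyMeasurable.integral_prod_right'
      (ih.comp (measurable_step measurable_fst measurable_snd ε)).stronglyMeasurable).measurable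

lemma integrable_of_mem_Icc {α : Type*} [MeasurableSpace α] {μ : Measure α} [IsFiniteMeasure μ]
    {F : α → ℝ} (hF : Measurable F) (h0 : ∀ a, 0 ≤ F a) (h1 : ∀ a, F a ≤ 1) :
    Integrable F μ :=
  Integrable.of_bound hF.aestronglyMeasurable 1 <| .of_forall fun a => by
    rw [Real.norm_eq_abs, abs_of_nonneg (h0 a)]; exact h1 a

lemma syncProb_le_one (t : ℕ) (x : Fin n → ℝ) : syncProb ε ν t x ≤ 1 := by
  induction t generalizing x with
  | zero => exact Set.indicator_apply_le' (fun _ => le_rfl) fun _ => zero_le_one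
  | succ t ih =>
    calc syncProb ε ν (t + 1) x = ∫ η, syncProb ε ν t (step ε x η) ∂ν := rfl
      _ ≤ ∫ _, 1 ∂ν := integral_mono
          (integrable_of_mem_Icc ((measurable_syncProb t).comp (measurable_step_right ε x))
            (fun _ => syncProb_nonneg _ _) fun _ => ih _) (integrable_const _) fun _ => ih _
      _ = 1 := by simp

lemma integrable_syncProb_step (t : ℕ) (x : Fin n → ℝ) :
    Integrable (fun η => syncProb ε ν t (step ε x η)) ν :=
  integrable_of_mem_Icc ((measurable_syncProb t).comp (measurable_step_right ε x))
    (fun _ => syncProb_nonneg _ _) fun _ => syncProb_le_one _ _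

lemma bddAbove_syncProb (x : Fin n → ℝ) : BddAbove (Set.range fun t => syncProb ε ν t x) :=
  ⟨1, by rintro _ ⟨t, rfl⟩; exact syncProb_le_one t x⟩

lemma syncProb_le_limSyncProb (t : ℕ) (x : Fin n → ℝ) :
    syncProb ε ν t x ≤ limSyncProb ε ν x :=
  le_ciSup (bddAbove_syncProb x) t

lemma limSyncProb_nonneg (x : Fin n → ℝ) : 0 ≤ limSyncProb ε ν x :=
  (syncProb_nonneg 0 x).trans (syncProb_le_limSyncProb 0 x)

lemma limSyncProb_le_one (x : Fin n → ℝ) : limSyncProb ε ν x ≤ 1 :=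
  ciSup_le fun t => syncProb_le_one t x

lemma measurable_limSyncProb : Measurable (limSyncProb ε ν) :=
  Measurable.iSup fun t => measurable_syncProb t

lemma integrable_limSyncProb_step (x : Fin n → ℝ) :
    Integrable (fun η => limSyncProb ε ν (step ε x η)) ν :=
  integrable_of_mem_Icc (measurable_limSyncProb.comp (measurable_step_right ε x))
    (fun _ => limSyncProb_nonneg _) fun _ => limSyncProb_le_one _

lemma limSyncProb_eq_one {x : Fin n → ℝ} (hx : x ∈ closeSet n ε) : limSyncProb ε ν x = 1 :=
  le_antisymm (limSyncProb_le_one x) <| by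
    simpa [syncProb, hx] using syncProb_le_limSyncProb (ε := ε) (ν := ν) 0 x

lemma monotone_syncProb (hν : ∀ᵐ η ∂ν, ∀ i j, η i - η j ≤ ε)
    (x : Fin n → ℝ) : Monotone fun t => syncProb ε ν t x := by
  refine monotone_nat_of_le_succ fun t => ?_
  induction t generalizing x with
  | zero =>
    by_cases hx : x ∈ closeSet n ε
    · have : syncProb ε ν 1 x = 1 := by
        have h1 : (fun η => syncProb ε ν 0 (step ε x η)) =ᵐ[ν] fun _ => 1 := by
          filter_upwards [hν] with η hη
          simp [syncProb, step_mem_closeSet hx hη]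
        calc syncProb ε ν 1 x = ∫ η, syncProb ε ν 0 (step ε x η) ∂ν := rfl
          _ = 1 := by rw [integral_congr_ae h1]; simp
      rw [zero_add, this]
      exact syncProb_le_one 0 x
    · simpa [syncProb, hx] using syncProb_nonneg (ε := ε) (ν := ν) 1 x
  | succ t ih =>
    exact integral_mono (integrable_syncProb_step t x) (integrable_syncProb_step (t + 1) x)
      fun η => ih _

lemma tendsto_syncProb (hν : ∀ᵐ η ∂ν, ∀ i j, η i - η j ≤ ε)
    (x : Fin n → ℝ) :
    Tendsto (fun t => syncProb ε ν t x) atTop (nhds (limSyncProb ε ν x)) :=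
  tendsto_atTop_ciSup (monotone_syncProb hν x) (bddAbove_syncProb x)

/-- The limiting probability of synchronization is a harmonic function of the initial state. -/
lemma limSyncProb_eq_integral (hν : ∀ᵐ η ∂ν, ∀ i j, η i - η j ≤ ε)
    (x : Fin n → ℝ) :
    limSyncProb ε ν x = ∫ η, limSyncProb ε ν (step ε x η) ∂ν := by
  refine tendsto_nhds_unique ((tendsto_syncProb hν x).comp (tendsto_add_atTop_nat 1)) ?_
  exact integral_tendsto_of_tendsto_of_monotone (fun t => integrable_syncProb_step t x)
    (integrable_limSyncProb_step x) (.of_forall fun η => monotone_syncProb hν _)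
    (.of_forall fun η => tendsto_syncProb hν _)

/-- A zero-one law: once the probability of synchronization is bounded below uniformly in the
initial state, it is identically one. -/
lemma limSyncProb_eq_one_of_le (hν : ∀ᵐ η ∂ν, ∀ i j, η i - η j ≤ ε)
    {c : ℝ} (hc : 0 < c) (h : ∀ x, c ≤ limSyncProb ε ν x)
    (x : Fin n → ℝ) : limSyncProb ε ν x = 1 := by
  have key : ∀ t x, 1 - limSyncProb ε ν x ≤ (1 - c) * (1 - syncProb ε ν t x) := by
    intro t
    induction t with
    | zero =>
      intro x
      by_cases hx : x ∈ closeSet n ε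
      · simp [syncProb, hx, limSyncProb_eq_one hx]
      · simp only [syncProb, Set.indicator_of_notMem hx]
        linarith [h x]
    | succ t ih =>
      intro x
      have h1 : 1 - limSyncProb ε ν x = ∫ η, (1 - limSyncProb ε ν (step ε x η)) ∂ν := by
        rw [integral_sub (integrable_const _) (integrable_limSyncProb_step x),
          ← limSyncProb_eq_integral hν]
        simp
      have h2 : (1 - c) * (1 - syncProb ε ν (t + 1) x) =
          ∫ η, (1 - c) * (1 - syncProb ε ν t (step ε x η)) ∂ν := by
        rw [integral_const_mul, integral_sub (integrable_const _) (integrable_syncProb_step t x)]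
        simp [syncProb]
      rw [h1, h2]
      exact integral_mono ((integrable_const _).sub (integrable_limSyncProb_step x))
        (((integrable_const _).sub (integrable_syncProb_step t x)).const_mul _) fun η => ih _
  have hlim : 1 - limSyncProb ε ν x ≤ (1 - c) * (1 - limSyncProb ε ν x) :=
    ge_of_tendsto' (((tendsto_syncProb hν x).const_sub 1).const_mul (1 - c)) fun t => key t x
  have := limSyncProb_le_one (ε := ε) (ν := ν) x
  nlinarith

lemma mul_le_limSyncProb (hν : ∀ᵐ η ∂ν, ∀ i j, η i - η j ≤ ε)
    {q c : ℝ} (hc : 0 ≤ c) {x : Fin n → ℝ} {E : Set (Fin n → ℝ)}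
    (hE : MeasurableSet E) (hq : q ≤ ν.real E)
    (h : ∀ᵐ η ∂ν, η ∈ E → c ≤ limSyncProb ε ν (step ε x η)) : q * c ≤ limSyncProb ε ν x := by
  calc q * c ≤ ν.real E * c := mul_le_mul_of_nonneg_right hq hc
    _ = ∫ η, E.indicator (fun _ => c) η ∂ν := by
        rw [integral_indicator hE, setIntegral_const, smul_eq_mul]
    _ ≤ ∫ η, limSyncProb ε ν (step ε x η) ∂ν := by
        refine integral_mono_ae ((integrable_const c).indicator hE)
          (integrable_limSyncProb_step x) ?_
        filter_upwards [h] with η hη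
        by_cases hm : η ∈ E
        · simpa [hm] using hη hm
        · simpa [hm] using limSyncProb_nonneg _
    _ = limSyncProb ε ν x := (limSyncProb_eq_integral hν x).symm

/-! ### Two separated groups meet -/

variable {g : Fin n → Fin n}

/-- The gap between the means of two separated groups of diameter at most `ε` is a centred random
walk with bounded steps, hence the groups stop being separated almost surely. The recurrence enters
through the concave Lyapunov function `z * (2 * (N + ε) - z)` of the gap `z`, which decreases in mean
by the variance of the steps as long as `z ≤ N`. -/
lemma le_limSyncProb_of_ordered_groups (hν : ∀ᵐ η ∂ν, ∀ i j, η i - η j ≤ ε)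
    (hε : 0 < ε) {i₀ j₀ : Fin n} (hne : g i₀ ≠ g j₀)
    (hmean : ∫ η, meanGap g i₀ j₀ η ∂ν = 0) (hvar : 0 < ∫ η, meanGap g i₀ j₀ η ^ 2 ∂ν)
    {c : ℝ} (hc1 : c ≤ 1)
    (hexit : ∀ y, IsGrouped g ε y → ¬ IsSeparated g ε y → c ≤ limSyncProb ε ν y)
    {x : Fin n → ℝ} (hg : IsGrouped g ε x) (hs : IsSeparated g ε x) (hlt : x j₀ < x i₀) :
    c ≤ limSyncProb ε ν x := by
  set Z := meanGap g i₀ j₀ with hZ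
  set σ := ∫ η, Z η ^ 2 ∂ν with hσ
  set f := limSyncProb ε ν with hf
  have hZm : Measurable Z := (continuous_meanGap g i₀ j₀).measurable
  have hZb : ∀ᵐ η ∂ν, |Z η| ≤ ε := by
    filter_upwards [hν] with η hη using abs_meanGap_le hη g i₀ j₀
  have hZi : Integrable Z ν := Integrable.of_bound hZm.aestronglyMeasurable ε hZb
  have hZi2 : Integrable (fun η => Z η ^ 2) ν := by
    refine Integrable.of_bound (hZm.pow_const 2).aestronglyMeasurable (ε ^ 2) ?_
    filter_upwards [hZb] with η hη
    rw [norm_pow, Real.norm_eq_abs]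
    exact pow_le_pow_left₀ (abs_nonneg _) hη 2
  -- one step of the comparison between `c - f` and the Lyapunov function
  have hstep : ∀ N > 0, ∀ s ≥ 0,
      (∀ y, IsGrouped g ε y → IsSeparated g ε y → y j₀ < y i₀ → Z y ≤ N →
        c - f y - Z y * (2 * (N + ε) - Z y) / N ^ 2 ≤ s) →
      ∀ y, IsGrouped g ε y → IsSeparated g ε y → y j₀ < y i₀ → Z y ≤ N →
        c - f y - Z y * (2 * (N + ε) - Z y) / N ^ 2 ≤ s - σ / N ^ 2 := by
    intro N hN s hs0 hs y hyg hys hylt hyN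
    have hN2 : 0 < N ^ 2 := by positivity
    set G : (Fin n → ℝ) → ℝ := fun η =>
      c - f (step ε y η) - (Z y + Z η) * (2 * (N + ε) - (Z y + Z η)) / N ^ 2 with hG
    have hGexp : G = fun η => (c - Z y * (2 * (N + ε) - Z y) / N ^ 2) - f (step ε y η) -
        (2 * (N + ε) - 2 * Z y) / N ^ 2 * Z η + 1 / N ^ 2 * Z η ^ 2 := by
      funext η
      simp only [hG]
      field_simp
      ring
    have hfi := integrable_limSyncProb_step (ε := ε) (ν := ν) y
    have hci : Integrable (fun _ : Fin n → ℝ => c - Z y * (2 * (N + ε) - Z y) / N ^ 2) ν :=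
      integrable_const _
    have hi1 := hci.sub hfi
    have hi2 := hi1.sub (hZi.const_mul ((2 * (N + ε) - 2 * Z y) / N ^ 2))
    have hi3 := hi2.add (hZi2.const_mul (1 / N ^ 2))
    have hGint : ∫ η, G η ∂ν =
        c - f y - Z y * (2 * (N + ε) - Z y) / N ^ 2 + σ / N ^ 2 := by
      rw [hGexp]
      have e1 := integral_add hi2 (hZi2.const_mul (1 / N ^ 2))
      have e2 := integral_sub hi1 (hZi.const_mul ((2 * (N + ε) - 2 * Z y) / N ^ 2))
      have e3 := integral_sub hci hfi
      simp only [Pi.sub_apply] at e1 e2 e3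
      rw [e1, e2, e3, integral_const_mul, integral_const_mul, hmean, ← hσ, hf,
        ← limSyncProb_eq_integral hν]
      simp
      ring
    have hle : ∫ η, G η ∂ν ≤ ∫ _, s ∂ν := by
      refine integral_mono_ae (by rw [hGexp]; exact hi3) (integrable_const s) ?_
      filter_upwards [hν, hZb] with η hη hZη
      have hz : Z (step ε y η) = Z y + Z η := meanGap_step hyg hys i₀ j₀
      have hzpos : ε < Z y := lt_meanGap hyg hys hne hylt
      have hg' := hyg.step_of_isSeparated hys hη
      rw [abs_le] at hZη
      have hQ : 0 ≤ (Z y + Z η) * (2 * (N + ε) - (Z y + Z η)) / N ^ 2 :=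
        div_nonneg (mul_nonneg (by linarith) (by linarith)) hN2.le
      by_cases hs' : IsSeparated g ε (step ε y η)
      · by_cases hzN : Z y + Z η ≤ N
        · simpa only [hG, hz] using
            hs _ hg' hs' (step_lt_step hyg hys hη hne hylt) (by rw [hz]; exact hzN)
        · push Not at hzN
          -- beyond `N` the Lyapunov function is at least `1 ≥ c`
          have h1 : 1 ≤ (Z y + Z η) * (2 * (N + ε) - (Z y + Z η)) / N ^ 2 := by
            rw [one_le_div hN2, sq]
            nlinarith
          have := limSyncProb_nonneg (ε := ε) (ν := ν) (step ε y η)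
          simp only [hG]
          linarith
      · have := hexit _ hg' hs'
        simp only [hG]
        linarith
    rw [hGint] at hle
    simp only [integral_const, probReal_univ, smul_eq_mul, one_mul] at hle
    linarith
  -- the comparison improves by a fixed amount each time, until it is sharp
  have hlyap : ∀ N > 0, Z x ≤ N → c - f x ≤ Z x * (2 * (N + ε) - Z x) / N ^ 2 := by
    intro N hN hxN
    have hδ : 0 < σ / N ^ 2 := by positivity
    have hiter : ∀ m : ℕ, ∀ y, IsGrouped g ε y → IsSeparated g ε y → y j₀ < y i₀ → Z y ≤ N →
        c - f y - Z y * (2 * (N + ε) - Z y) / N ^ 2 ≤ max 0 (1 - m * (σ / N ^ 2)) := by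
      intro m
      induction m with
      | zero =>
        intro y hyg hys hylt hyN
        have hzpos : ε < Z y := lt_meanGap hyg hys hne hylt
        have hQ : 0 ≤ Z y * (2 * (N + ε) - Z y) / N ^ 2 :=
          div_nonneg (mul_nonneg (by linarith) (by linarith)) (by positivity)
        have := limSyncProb_nonneg (ε := ε) (ν := ν) y
        simp only [CharP.cast_eq_zero, zero_mul, sub_zero]
        exact le_max_of_le_right (by linarith)
      | succ m ih =>
        intro y hyg hys hylt hyN
        refine (hstep N hN _ (le_max_left _ _) ih y hyg hys hylt hyN).trans ?_
        push_cast
        rcases le_total 0 (1 - m * (σ / N ^ 2)) with h | h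
        · rw [max_eq_right h]
          exact le_max_of_le_right (by linarith)
        · rw [max_eq_left h]
          exact le_max_of_le_left (by linarith)
    obtain ⟨m, hm⟩ := exists_nat_gt (1 / (σ / N ^ 2))
    rw [div_lt_iff₀ hδ] at hm
    have := hiter m x hg hs hlt hxN
    rw [max_eq_left (by linarith)] at this
    linarith
  have hx0 : ε < Z x := lt_meanGap hg hs hne hlt
  have hlim : Tendsto (fun N : ℝ => 4 * Z x / N) atTop (nhds 0) :=
    tendsto_const_nhds.div_atTop tendsto_id
  have : c - f x ≤ 0 := by
    refine ge_of_tendsto hlim ?_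
    filter_upwards [eventually_ge_atTop (Z x)] with N hN
    have hNpos : 0 < N := by linarith
    refine (hlyap N hNpos hN).trans ?_
    rw [div_le_div_iff₀ (by positivity) hNpos]
    have h1 : Z x * (2 * (N + ε) - Z x) ≤ 4 * Z x * N := by nlinarith
    nlinarith
  linarith

end SyncProb

/-! ### A uniform lower bound by merging groups -/

section Merging

variable {n : ℕ} {ε a b : ℝ} {μ : Measure ℝ} [IsProbabilityMeasure μ]

lemma ae_pi_sub_le {δ₁ δ₂ : ℝ} (hδ : δ₂ - δ₁ = ε) (hμ : ∀ᵐ t ∂μ, t ∈ Set.Icc δ₁ δ₂) (n : ℕ) :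
    ∀ᵐ η ∂(Measure.pi fun _ : Fin n => μ), ∀ i j, η i - η j ≤ ε := by
  have h : ∀ i : Fin n, ∀ᵐ η ∂(Measure.pi fun _ : Fin n => μ), η i ∈ Set.Icc δ₁ δ₂ := fun i =>
    (measurePreserving_eval (fun _ : Fin n => μ) i).quasiMeasurePreserving.ae hμ
  filter_upwards [ae_all_iff.2 h] with η hη i j
  linarith [(hη i).2, (hη j).1]

lemma integral_meanGap_pi (hμ : Integrable (fun t => t) μ) (g : Fin n → Fin n) (i₀ j₀ : Fin n) :
    ∫ η, meanGap g i₀ j₀ η ∂(Measure.pi fun _ : Fin n => μ) = 0 := by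
  have hmp := fun i : Fin n => measurePreserving_eval (fun _ : Fin n => μ) i
  have hint : ∀ i : Fin n, Integrable (fun η : Fin n → ℝ => η i) (Measure.pi fun _ => μ) :=
    fun i => (hmp i).integrable_comp_of_integrable hμ
  have hval : ∀ i : Fin n, ∫ η : Fin n → ℝ, η i ∂(Measure.pi fun _ => μ) = ∫ t, t ∂μ := fun i => by
    have h := integral_map (μ := Measure.pi fun _ : Fin n => μ) (hmp i).measurable.aemeasurable
      (f := fun t : ℝ => t) aestronglyMeasurable_id
    rw [(hmp i).map_eq] at h
    exact h.symm
  unfold meanGap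
  rw [integral_sub ((integrable_finsetSum _ fun i _ => hint i).const_mul _)
    ((integrable_finsetSum _ fun i _ => hint i).const_mul _), integral_const_mul,
    integral_const_mul, integral_finsetSum _ fun i _ => hint i,
    integral_finsetSum _ fun i _ => hint i]
  have h1 := (card_group_pos g i₀).ne'
  have h2 := (card_group_pos g j₀).ne'
  simp only [hval, Finset.sum_const, nsmul_eq_mul]
  field_simp
  ring

lemma integral_meanGap_sq_pi_pos (ha : a ∈ μ.support) (hb : b ∈ μ.support) (hab : a < b)
    {g : Fin n → Fin n} {i₀ j₀ : Fin n} (hne : g i₀ ≠ g j₀)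
    (hν : ∀ᵐ η ∂(Measure.pi fun _ : Fin n => μ), ∀ i j, η i - η j ≤ ε) :
    0 < ∫ η, meanGap g i₀ j₀ η ^ 2 ∂(Measure.pi fun _ : Fin n => μ) := by
  have hm := (continuous_meanGap g i₀ j₀).measurable
  have hint : Integrable (fun η => meanGap g i₀ j₀ η ^ 2) (Measure.pi fun _ : Fin n => μ) := by
    refine Integrable.of_bound (hm.pow_const 2).aestronglyMeasurable (ε ^ 2) ?_
    filter_upwards [hν] with η hη
    rw [norm_pow, Real.norm_eq_abs]
    exact pow_le_pow_left₀ (abs_nonneg _) (abs_meanGap_le hη g i₀ j₀) 2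
  obtain ⟨q, hq, hqle⟩ := exists_le_pi_pattern μ ha hb (r := (b - a) / 4) (by linarith) n
  rw [integral_pos_iff_support_of_nonneg (fun _ => sq_nonneg _) hint]
  have hsub : {η : Fin n → ℝ |
        ∀ i, |η i - (if decide (g i = g i₀) then b else a)| ≤ (b - a) / 4} ⊆
      Function.support fun η => meanGap g i₀ j₀ η ^ 2 := by
    intro η hη
    have hη' := fun i => abs_le.1 (hη i)
    have h1 := (mean_group_mem_Icc g (i := i₀) (y := η) (m := b - (b - a) / 4)
      (M := b + (b - a) / 4) fun j hj => by
        have := hη' j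
        simp only [hj, decide_true, if_true] at this
        constructor <;> linarith).1
    have h2 := (mean_group_mem_Icc g (i := j₀) (y := η) (m := a - (b - a) / 4)
      (M := a + (b - a) / 4) fun j hj => by
        have := hη' j
        simp only [hj, hne.symm, decide_false, Bool.false_eq_true, if_false] at this
        constructor <;> linarith).2
    have h3 : 0 < meanGap g i₀ j₀ η := by
      unfold meanGap
      linarith
    exact (pow_pos h3 2).ne'
  refine lt_of_lt_of_le ?_ (measure_mono hsub)
  have := hq.trans_le (hqle fun i => decide (g i = g i₀))
  exact (ENNReal.toReal_pos_iff.1 this).1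

/-- Separated groups are steered to diameter at most `ε`, where the bound `c` is available, before
they can come close to each other. -/
lemma pow_mul_le_limSyncProb_of_separated {ν : Measure (Fin n → ℝ)} [IsProbabilityMeasure ν]
    (hν : ∀ᵐ η ∂ν, ∀ i j, η i - η j ≤ ε) (hε : 0 < ε) {r q c : ℝ} (hr0 : 0 ≤ r)
    (hr : 6 * r ≤ ε) (hab : 3 * r ≤ b - a) (hq : 0 < q) (hc : 0 ≤ c)
    (hpat : ∀ s : Fin n → Bool, q ≤ ν.real {η | ∀ i, |η i - (if s i then b else a)| ≤ r})
    {g : Fin n → Fin n}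
    (hbase : ∀ y, IsGrouped g ε y → IsSeparated g ε y → c ≤ limSyncProb ε ν y) (K : ℕ)
    {x : Fin n → ℝ} (hg : IsGrouped g (ε + K * r) x)
    (hs : IsSeparated g (ε + K * (3 * ε)) x) : q ^ K * c ≤ limSyncProb ε ν x := by
  induction K generalizing x with
  | zero => simpa using hbase x (by simpa using hg) (by simpa using hs)
  | succ K ih =>
    push_cast at hg hs
    have hK : (0 : ℝ) ≤ K := Nat.cast_nonneg K
    have hsε : IsSeparated g ε x := fun i j hij =>
      lt_of_le_of_lt (by nlinarith) (hs i j hij)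
    obtain ⟨s, hsteer⟩ := exists_steering hε.le (by nlinarith) hr hab hg hsε
    rw [pow_succ', mul_assoc]
    refine mul_le_limSyncProb hν (by positivity) (measurableSet_pattern a b r s) (hpat s) ?_
    filter_upwards [hν] with η hη hηs
    refine ih (fun i j hij => (hsteer η hη hηs i j hij).trans (max_le (by nlinarith) ?_)) ?_
    · linarith
    · refine IsSeparated.step hε.le (fun i j hij => ?_) hη
      have := hs i j hij
      linarith

/-- By induction on the number `k` of groups: whenever the agents form at most `k` groups of
diameter at most `R`, synchronization has a probability bounded below in terms of `k` and `R`.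
Either two groups are close already and are merged into one, or all groups contract while still
being far apart, and then two of them eventually meet by recurrence of the random walk. -/
lemma exists_le_limSyncProb_of_groups (hε : 0 < ε) {δ₁ δ₂ : ℝ} (hδ : δ₂ - δ₁ = ε)
    (hμ : ∀ᵐ t ∂μ, t ∈ Set.Icc δ₁ δ₂) (ha : a ∈ μ.support) (hb : b ∈ μ.support) (hab : a < b)
    (hn : 0 < n) (k : ℕ) (R : ℝ) :
    ∃ c > 0, ∀ (g : Fin n → Fin n) (x : Fin n → ℝ), (Finset.univ.image g).card ≤ k →
      IsGrouped g R x → c ≤ limSyncProb ε (Measure.pi fun _ : Fin n => μ) x := by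
  have hν := ae_pi_sub_le hδ hμ n
  set ν := Measure.pi fun _ : Fin n => μ with hνdef
  induction k generalizing R with
  | zero =>
    refine ⟨1, one_pos, fun g x hcard _ => ?_⟩
    rw [Nat.le_zero, Finset.card_eq_zero, Finset.image_eq_empty] at hcard
    have : (⟨0, hn⟩ : Fin n) ∈ (Finset.univ : Finset (Fin n)) := Finset.mem_univ _
    simp [hcard] at this
  | succ k ih =>
    -- two groups of diameter at most `R` with members at distance at most `L` can be merged
    have hmerge : ∀ R L : ℝ, 0 ≤ R → 0 ≤ L → ∃ c > 0, ∀ (g : Fin n → Fin n) (x : Fin n → ℝ),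
        (Finset.univ.image g).card ≤ k + 1 → IsGrouped g R x → ¬ IsSeparated g L x →
        c ≤ limSyncProb ε ν x := by
      intro R L hR hL
      obtain ⟨c, hc, h⟩ := ih (2 * R + L)
      refine ⟨c, hc, fun g x hcard hg hs => ?_⟩
      simp only [IsSeparated, not_forall, not_lt] at hs
      obtain ⟨i₀, j₀, hne, hclose⟩ := hs
      refine h (fun i => if g i = g j₀ then g i₀ else g i) x ?_ ?_
      · have hsub : (Finset.univ.image fun i => if g i = g j₀ then g i₀ else g i) ⊆
            (Finset.univ.image g).erase (g j₀) := by
          intro l hl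
          simp only [Finset.mem_image, Finset.mem_univ, true_and] at hl
          obtain ⟨i, rfl⟩ := hl
          simp only [Finset.mem_erase, Finset.mem_image, Finset.mem_univ, true_and]
          split_ifs with hi
          · exact ⟨hne, i₀, rfl⟩
          · exact ⟨hi, i, rfl⟩
        have := Finset.card_le_card hsub
        rw [Finset.card_erase_of_mem (by simp)] at this
        omega
      · have hcl := abs_le.1 hclose
        intro i j hij
        have habs : ∀ i j, g i = g j → x i - x j ≤ R ∧ x j - x i ≤ R := fun i j h => by
          have := abs_le.1 (hg i j h)
          constructor <;> linarith
        simp only at hij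
        rw [abs_le]
        split_ifs at hij with h1 h2 h2
        · have := habs i j (h1.trans h2.symm)
          constructor <;> linarith
        · have := habs i j₀ h1
          have := habs i₀ j hij
          constructor <;> linarith
        · have := habs j j₀ h2
          have := habs i i₀ hij
          constructor <;> linarith
        · have := habs i j hij
          constructor <;> linarith
    -- separated groups of diameter at most `ε` eventually meet
    obtain ⟨c₀, hc₀, hc₀le⟩ := hmerge ε ε hε.le hε.le
    have hbase : ∀ (g : Fin n → Fin n), (Finset.univ.image g).card ≤ k + 1 →
        ∀ y, IsGrouped g ε y → IsSeparated g ε y → min c₀ 1 ≤ limSyncProb ε ν y := by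
      intro g hcard y hg hs
      by_cases hone : ∀ i j, g i = g j
      · rw [limSyncProb_eq_one fun i j => hg i j (hone i j)]
        exact min_le_right _ _
      · push Not at hone
        obtain ⟨i₀, j₀, hne⟩ := hone
        have hid : Integrable (fun t => t) μ := by
          refine Integrable.of_bound aestronglyMeasurable_id (max |δ₁| |δ₂|) ?_
          filter_upwards [hμ] with t ht using abs_le_max_abs_abs ht.1 ht.2
        have hexit : ∀ y, IsGrouped g ε y → ¬ IsSeparated g ε y →
            min c₀ 1 ≤ limSyncProb ε ν y := fun y hy hy' =>
          (min_le_left _ _).trans (hc₀le g y hcard hy hy')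
        have hord : ∀ i j, g i ≠ g j → y j < y i → min c₀ 1 ≤ limSyncProb ε ν y :=
          fun i j hij hlt => le_limSyncProb_of_ordered_groups hν hε hij
            (integral_meanGap_pi hid g i j) (integral_meanGap_sq_pi_pos ha hb hab hij hν)
            (min_le_right _ _) hexit hg hs hlt
        rcases lt_trichotomy (y i₀) (y j₀) with h | h | h
        · exact hord j₀ i₀ hne.symm h
        · have := hs i₀ j₀ hne
          rw [h, sub_self, abs_zero] at this
          linarith
        · exact hord i₀ j₀ hne h
    set r := min (ε / 6) ((b - a) / 3) with hr
    have hr0 : 0 < r := lt_min (by linarith) (by linarith)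
    have hr1 : 6 * r ≤ ε := by linarith [min_le_left (ε / 6) ((b - a) / 3)]
    have hr2 : 3 * r ≤ b - a := by linarith [min_le_right (ε / 6) ((b - a) / 3)]
    obtain ⟨q, hq, hpat⟩ := exists_le_pi_pattern μ ha hb hr0 n
    obtain ⟨K, hK⟩ := exists_nat_gt (R / r)
    rw [div_lt_iff₀ hr0] at hK
    have hK0 : (0 : ℝ) ≤ K := Nat.cast_nonneg K
    obtain ⟨c₁, hc₁, hc₁le⟩ := hmerge (ε + K * r) (ε + K * (3 * ε)) (by positivity) (by positivity)
    have hc01 : 0 < min c₀ 1 := lt_min hc₀ one_pos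
    refine ⟨min c₁ (q ^ K * min c₀ 1), lt_min hc₁ (by positivity), fun g x hcard hg => ?_⟩
    have hg' : IsGrouped g (ε + K * r) x := fun i j hij => (hg i j hij).trans (by linarith)
    by_cases hs : IsSeparated g (ε + K * (3 * ε)) x
    · exact (min_le_right _ _).trans (pow_mul_le_limSyncProb_of_separated hν hε hr0.le hr1 hr2 hq
        hc01.le hpat (hbase g hcard) K hg' hs)
    · exact (min_le_left _ _).trans (hc₁le g x hcard hg' hs)

lemma limSyncProb_pi_eq_one (hε : 0 < ε) {δ₁ δ₂ : ℝ} (hδ : δ₂ - δ₁ = ε)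
    (hμ : ∀ᵐ t ∂μ, t ∈ Set.Icc δ₁ δ₂) (ha : a ∈ μ.support) (hb : b ∈ μ.support) (hab : a < b)
    (hn : 0 < n) (x : Fin n → ℝ) : limSyncProb ε (Measure.pi fun _ : Fin n => μ) x = 1 := by
  obtain ⟨c, hc, h⟩ := exists_le_limSyncProb_of_groups hε hδ hμ ha hb hab hn n 0
  refine limSyncProb_eq_one_of_le (ae_pi_sub_le hδ hμ n) hc (fun x => h id x ?_ ?_) x
  · simp
  · rintro i j rfl
    simp

end Merging

/-! ### Escape from synchronization -/

/-- If the noise reaches two values more than `ε` apart, every step ends with a diameter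
bounded away from `ε` with a probability bounded below: of two agents, the one with the larger
average receives the larger noise. -/
lemma exists_real_step_mem_closeSet_le {n : ℕ} {ε a b : ℝ} (μ : Measure ℝ) [IsProbabilityMeasure μ]
    (ha : a ∈ μ.support) (hb : b ∈ μ.support) (hab : ε < b - a) (hn : 2 ≤ n) :
    ∃ ρ > ε, ∃ q > 0, ∀ x : Fin n → ℝ,
      (Measure.pi fun _ : Fin n => μ).real {η | step ε x η ∈ closeSet n ρ} ≤ 1 - q := by
  obtain ⟨q, hq, hpat⟩ := exists_le_pi_pattern μ ha hb (r := (b - a - ε) / 4) (by linarith) n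
  refine ⟨ε + (b - a - ε) / 4, by linarith, q, hq, fun x => ?_⟩
  obtain ⟨i, j, hij, hle⟩ : ∃ i j : Fin n, i ≠ j ∧ localAverage ε x i ≤ localAverage ε x j := by
    have h01 : (⟨0, by omega⟩ : Fin n) ≠ ⟨1, by omega⟩ := by simp
    rcases le_total (localAverage ε x ⟨0, by omega⟩) (localAverage ε x ⟨1, by omega⟩) with h | h
    · exact ⟨_, _, h01, h⟩
    · exact ⟨_, _, h01.symm, h⟩
  set E := {η : Fin n → ℝ | ∀ k, |η k - (if decide (k = j) then b else a)| ≤ (b - a - ε) / 4}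
  have hE : MeasurableSet E := measurableSet_pattern a b _ _
  have hsub : {η | step ε x η ∈ closeSet n (ε + (b - a - ε) / 4)} ⊆ Eᶜ := by
    intro η hη hηE
    have h1 := abs_le.1 (hηE i)
    have h2 := abs_le.1 (hηE j)
    have h3 := abs_le.1 (hη j i)
    simp only [hij, decide_false, decide_true, Bool.false_eq_true, if_true, if_false] at h1 h2
    simp only [step] at h3
    linarith
  refine (measureReal_mono hsub).trans ?_
  rw [probReal_compl_eq_one_sub hE]
  linarith [hpat fun k => decide (k = j)]

/-! ### The dynamics as a Markov chain -/

lemma state_succ {Ω : Type*} {n : ℕ} (ε : ℝ) (x₀ : Fin n → ℝ) (ξ : Fin n → ℕ → Ω → ℝ) (t : ℕ) (ω : Ω) :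
    state ε x₀ ξ (t + 1) ω = step ε (state ε x₀ ξ t ω) fun i => ξ i (t + 1) ω := rfl

section Chain

variable {Ω : Type*} [MeasurableSpace Ω] {P : Measure Ω} {n : ℕ}
  {ξ : Fin n → ℕ → Ω → ℝ} {μ : Measure ℝ}

lemma measurable_state (hmeas : ∀ i t, Measurable (ξ i (t + 1))) (ε : ℝ) (x₀ : Fin n → ℝ) (t : ℕ) :
    Measurable (state ε x₀ ξ t) := by
  induction t with
  | zero => exact measurable_const
  | succ t ih =>
    exact measurable_step ih (measurable_pi_lambda _ fun i => hmeas i t) ε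

/-- The path up to time `t`, frozen afterwards, is independent of the noise at time `t + 1`: it is
a measurable function of the noises up to time `t`. -/
lemma indepFun_path_noise (hmeas : ∀ i t, Measurable (ξ i (t + 1)))
    (hindep : iIndepFun (fun p : Fin n × ℕ => ξ p.1 (p.2 + 1)) P) (ε : ℝ) (x₀ : Fin n → ℝ) (t : ℕ) :
    IndepFun (fun ω (s : ℕ) => state ε x₀ ξ (min s t) ω) (fun ω i => ξ i (t + 1) ω) P := by
  classical
  set S : Finset (Fin n × ℕ) := Finset.univ ×ˢ Finset.range t with hS
  set T : Finset (Fin n × ℕ) := Finset.univ ×ˢ {t} with hT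
  have hdisj : Disjoint S T := by
    rw [Finset.disjoint_left]
    rintro ⟨i, s⟩ h1 h2
    simp only [hS, hT, Finset.mem_product, Finset.mem_range, Finset.mem_singleton] at h1 h2
    omega
  have h := hindep.indepFun_finset S T hdisj fun p => hmeas p.1 p.2
  -- the same dynamics, realized on the space of noises indexed by `S`
  let ξ' : Fin n → ℕ → (S → ℝ) → ℝ := fun i s w =>
    if hp : (i, s - 1) ∈ S then w ⟨(i, s - 1), hp⟩ else 0
  have hξ' : ∀ i s, Measurable (ξ' i s) := by
    intro i s
    by_cases hp : (i, s - 1) ∈ S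
    · simp only [ξ', hp, dif_pos]
      exact measurable_pi_apply _
    · simp only [ξ', hp, dif_neg, not_false_eq_true]
      exact measurable_const
  have hstate : ∀ s ≤ t, ∀ ω,
      state ε x₀ ξ' s (fun p : S => ξ p.1.1 (p.1.2 + 1) ω) = state ε x₀ ξ s ω := by
    intro s
    induction s with
    | zero => exact fun _ _ => rfl
    | succ s ih =>
      intro hs ω
      rw [state_succ, state_succ, ih (by omega)]
      congr 1
      funext i
      have hp : (i, s + 1 - 1) ∈ S := by
        simp only [hS, Finset.mem_product, Finset.mem_univ, Finset.mem_range, true_and]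
        omega
      simp only [ξ', hp, dif_pos]
      rfl
  have hφ : Measurable fun (w : S → ℝ) (s : ℕ) => state ε x₀ ξ' (min s t) w :=
    measurable_pi_lambda _ fun s => measurable_state (fun i t => hξ' i (t + 1)) ε x₀ _
  have hψ : Measurable fun (w : T → ℝ) (i : Fin n) => w ⟨(i, t), by simp [hT]⟩ :=
    measurable_pi_lambda _ fun i => measurable_pi_apply _
  have hpath : (fun ω (s : ℕ) => state ε x₀ ξ (min s t) ω) =
      (fun (w : S → ℝ) (s : ℕ) => state ε x₀ ξ' (min s t) w) ∘
        fun ω (p : S) => ξ p.1.1 (p.1.2 + 1) ω := by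
    funext ω s
    exact (hstate _ (min_le_right _ _) ω).symm
  rw [hpath]
  exact h.comp hφ hψ

variable [IsProbabilityMeasure P]

lemma map_noise_eq_pi (hmeas : ∀ i t, Measurable (ξ i (t + 1)))
    (hindep : iIndepFun (fun p : Fin n × ℕ => ξ p.1 (p.2 + 1)) P)
    (hlaw : ∀ i t, P.map (ξ i (t + 1)) = μ) (t : ℕ) :
    P.map (fun ω i => ξ i (t + 1) ω) = Measure.pi fun _ : Fin n => μ := by
  have hinj : Function.Injective fun i : Fin n => (i, t) := fun i j h => (Prod.mk.inj h).1
  rw [(iIndepFun_iff_map_fun_eq_pi_map fun i => (hmeas i t).aemeasurable).1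
    (hindep.precomp hinj)]
  simp only [hlaw]

variable [IsProbabilityMeasure μ]

/-- The Markov property: given the path up to time `t`, the noise at time `t + 1` may be integrated
out. -/
lemma integral_path_noise (hmeas : ∀ i t, Measurable (ξ i (t + 1)))
    (hindep : iIndepFun (fun p : Fin n × ℕ => ξ p.1 (p.2 + 1)) P)
    (hlaw : ∀ i t, P.map (ξ i (t + 1)) = μ) (ε : ℝ) (x₀ : Fin n → ℝ) (t : ℕ)
    {F : (ℕ → Fin n → ℝ) × (Fin n → ℝ) → ℝ} (hF : Measurable F) (h0 : ∀ p, 0 ≤ F p)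
    (h1 : ∀ p, F p ≤ 1) :
    ∫ ω, F (fun s => state ε x₀ ξ (min s t) ω, fun i => ξ i (t + 1) ω) ∂P =
      ∫ ω, ∫ η, F (fun s => state ε x₀ ξ (min s t) ω, η) ∂(Measure.pi fun _ : Fin n => μ) ∂P := by
  have hpath : Measurable fun ω (s : ℕ) => state ε x₀ ξ (min s t) ω :=
    measurable_pi_lambda _ fun s => measurable_state hmeas ε x₀ _
  have hnoise : Measurable fun ω i => ξ i (t + 1) ω := measurable_pi_lambda _ fun i => hmeas i t
  have hprod := (indepFun_iff_map_prod_eq_prod_map_map hpath.aemeasurable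
    hnoise.aemeasurable).1 (indepFun_path_noise hmeas hindep ε x₀ t)
  rw [map_noise_eq_pi hmeas hindep hlaw] at hprod
  have : IsProbabilityMeasure (P.map fun ω (s : ℕ) => state ε x₀ ξ (min s t) ω) :=
    Measure.isProbabilityMeasure_map hpath.aemeasurable
  rw [← integral_map (φ := fun ω => ((fun s => state ε x₀ ξ (min s t) ω : ℕ → Fin n → ℝ),
    (fun i => ξ i (t + 1) ω : Fin n → ℝ))) (hpath.prodMk hnoise).aemeasurable
    hF.aestronglyMeasurable, hprod, integral_prod F (integrable_of_mem_Icc hF h0 h1),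
    integral_map hpath.aemeasurable
      (StronglyMeasurable.integral_prod_right' hF.stronglyMeasurable).aestronglyMeasurable]

lemma measureReal_state_mem_closeSet (hmeas : ∀ i t, Measurable (ξ i (t + 1)))
    (hindep : iIndepFun (fun p : Fin n × ℕ => ξ p.1 (p.2 + 1)) P)
    (hlaw : ∀ i t, P.map (ξ i (t + 1)) = μ) (ε : ℝ) (x₀ : Fin n → ℝ) (t : ℕ) :
    P.real {ω | state ε x₀ ξ t ω ∈ closeSet n ε} =
      syncProb ε (Measure.pi fun _ : Fin n => μ) t x₀ := by
  have hiter : ∀ s t, ∫ ω, syncProb ε (Measure.pi fun _ : Fin n => μ) s (state ε x₀ ξ t ω) ∂P =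
      ∫ ω, syncProb ε (Measure.pi fun _ : Fin n => μ) 0 (state ε x₀ ξ (t + s) ω) ∂P := by
    intro s
    induction s with
    | zero => exact fun t => rfl
    | succ s ih =>
      intro t
      have hF : Measurable fun p : (ℕ → Fin n → ℝ) × (Fin n → ℝ) =>
          syncProb ε (Measure.pi fun _ : Fin n => μ) s (step ε (p.1 t) p.2) :=
        (measurable_syncProb s).comp
          (measurable_step ((measurable_pi_apply t).comp measurable_fst) measurable_snd ε)
      have h := integral_path_noise hmeas hindep hlaw ε x₀ t hF
        (fun _ => syncProb_nonneg _ _) (fun _ => syncProb_le_one _ _)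
      simp only [min_self, ← state_succ] at h
      rw [show t + (s + 1) = t + 1 + s by ring, ← ih (t + 1), h]
      rfl
  have h0 : ∫ ω, syncProb ε (Measure.pi fun _ : Fin n => μ) t (state ε x₀ ξ 0 ω) ∂P =
      syncProb ε (Measure.pi fun _ : Fin n => μ) t x₀ := by
    simp [state]
  rw [← h0, hiter t 0, zero_add]
  have hset : MeasurableSet {ω | state ε x₀ ξ t ω ∈ closeSet n ε} :=
    measurable_state hmeas ε x₀ t (measurableSet_closeSet n ε)
  rw [← integral_indicator_one hset]
  rfl

/-- A probability `1 - q` of staying in `closeSet n ρ` for one step, uniform in the state, makes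
the probability of staying there for `k` consecutive steps at most `(1 - q) ^ k`. -/
lemma measureReal_forall_state_mem_closeSet_le (hmeas : ∀ i t, Measurable (ξ i (t + 1)))
    (hindep : iIndepFun (fun p : Fin n × ℕ => ξ p.1 (p.2 + 1)) P)
    (hlaw : ∀ i t, P.map (ξ i (t + 1)) = μ) {ε ρ q : ℝ} (x₀ : Fin n → ℝ) (hq : q ≤ 1)
    (h : ∀ x : Fin n → ℝ,
      (Measure.pi fun _ : Fin n => μ).real {η | step ε x η ∈ closeSet n ρ} ≤ 1 - q) (t k : ℕ) :
    P.real {ω | ∀ s, t ≤ s → s ≤ t + k → state ε x₀ ξ s ω ∈ closeSet n ρ} ≤ (1 - q) ^ k := by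
  induction k with
  | zero => simp
  | succ k ih =>
    set A : Set (ℕ → Fin n → ℝ) := {p | ∀ s, t ≤ s → s ≤ t + k → p s ∈ closeSet n ρ} with hA
    have hAm : MeasurableSet A := by
      simp only [hA, Set.ofPred_forall]
      exact MeasurableSet.iInter fun s => MeasurableSet.iInter fun _ => MeasurableSet.iInter fun _ =>
        measurable_pi_apply s (measurableSet_closeSet n ρ)
    set B : Set ((ℕ → Fin n → ℝ) × (Fin n → ℝ)) :=
      {p | p.1 ∈ A ∧ step ε (p.1 (t + k)) p.2 ∈ closeSet n ρ} with hB
    have hBm : MeasurableSet B :=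
      (measurable_fst hAm).inter
        (measurable_step ((measurable_pi_apply (t + k)).comp measurable_fst) measurable_snd ε
          (measurableSet_closeSet n ρ))
    have hmk := integral_path_noise hmeas hindep hlaw ε x₀ (t + k)
      (F := B.indicator 1) (measurable_one.indicator hBm)
      (fun _ => Set.indicator_nonneg (fun _ _ => zero_le_one) _)
      (fun _ => Set.indicator_apply_le' (fun _ => le_rfl) fun _ => zero_le_one)
    have hpath : Measurable fun ω (s : ℕ) => state ε x₀ ξ (min s (t + k)) ω :=
      measurable_pi_lambda _ fun s => measurable_state hmeas ε x₀ _
    have hset : ∀ ω, (fun s => state ε x₀ ξ (min s (t + k)) ω) ∈ A ↔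
        ∀ s, t ≤ s → s ≤ t + k → state ε x₀ ξ s ω ∈ closeSet n ρ := by
      intro ω
      refine forall_congr' fun s => forall_congr' fun _ => forall_congr' fun hs => ?_
      simp only [min_eq_left hs]
    have hAP : MeasurableSet {ω | ∀ s, t ≤ s → s ≤ t + k → state ε x₀ ξ s ω ∈ closeSet n ρ} := by
      simp only [← hset]
      exact hpath hAm
    have hnext : ∀ ω, (∀ s, t ≤ s → s ≤ t + (k + 1) → state ε x₀ ξ s ω ∈ closeSet n ρ) ↔
        ((fun s => state ε x₀ ξ (min s (t + k)) ω, fun i => ξ i (t + k + 1) ω) :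
          (ℕ → Fin n → ℝ) × (Fin n → ℝ)) ∈ B := by
      intro ω
      simp only [hB, Set.mem_ofPred_eq, hset, min_self, ← state_succ]
      constructor
      · exact fun hω => ⟨fun s h1 h2 => hω s h1 (by omega), hω _ (by omega) (by omega)⟩
      · rintro ⟨h1, h2⟩ s hs hs'
        rcases Nat.lt_or_ge (t + k) s with hlt | hle
        · obtain rfl : s = t + k + 1 := by omega
          exact h2
        · exact h1 s hs hle
    have hnextm : MeasurableSet
        {ω | ∀ s, t ≤ s → s ≤ t + (k + 1) → state ε x₀ ξ s ω ∈ closeSet n ρ} := by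
      simp only [hnext]
      exact (hpath.prodMk (measurable_pi_lambda _ fun i => hmeas i (t + k))) hBm
    calc P.real {ω | ∀ s, t ≤ s → s ≤ t + (k + 1) → state ε x₀ ξ s ω ∈ closeSet n ρ}
        = ∫ ω, B.indicator 1 (fun s => state ε x₀ ξ (min s (t + k)) ω,
            fun i => ξ i (t + k + 1) ω) ∂P := by
          rw [← integral_indicator_one hnextm]
          simp only [hnext]
          rfl
      _ = ∫ ω, ∫ η, B.indicator 1 (fun s => state ε x₀ ξ (min s (t + k)) ω, η)
            ∂(Measure.pi fun _ : Fin n => μ) ∂P := hmk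
      _ ≤ ∫ ω, {ω | ∀ s, t ≤ s → s ≤ t + k → state ε x₀ ξ s ω ∈ closeSet n ρ}.indicator
            (fun _ => 1 - q) ω ∂P := by
          refine integral_mono_of_nonneg (.of_forall fun ω => integral_nonneg fun η =>
            Set.indicator_nonneg (fun _ _ => zero_le_one) _)
            ((integrable_const _).indicator hAP) (.of_forall fun ω => ?_)
          by_cases hω : ∀ s, t ≤ s → s ≤ t + k → state ε x₀ ξ s ω ∈ closeSet n ρ
          · rw [Set.indicator_of_mem (by exact hω)]
            refine le_trans (le_of_eq ?_) (h (state ε x₀ ξ (t + k) ω))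
            have hm : MeasurableSet {η | step ε (state ε x₀ ξ (t + k) ω) η ∈ closeSet n ρ} :=
              measurable_step_right ε _ (measurableSet_closeSet n ρ)
            rw [← integral_indicator_one hm]
            refine integral_congr_ae (.of_forall fun η => ?_)
            have hiff : ((fun s => state ε x₀ ξ (min s (t + k)) ω, η) :
                (ℕ → Fin n → ℝ) × (Fin n → ℝ)) ∈ B ↔
                step ε (state ε x₀ ξ (t + k) ω) η ∈ closeSet n ρ := by
              simp only [hB, Set.mem_ofPred_eq, hset, min_self]
              exact and_iff_right hω
            by_cases hη : step ε (state ε x₀ ξ (t + k) ω) η ∈ closeSet n ρ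
            · exact (Set.indicator_of_mem (hiff.2 hη) 1).trans (Set.indicator_of_mem hη 1).symm
            · exact (Set.indicator_of_notMem (mt hiff.1 hη) 1).trans
                (Set.indicator_of_notMem hη 1).symm
          · rw [Set.indicator_of_notMem (by exact hω)]
            refine le_of_eq (integral_eq_zero_of_ae (.of_forall fun η => ?_))
            refine Set.indicator_of_notMem (fun hm => hω ?_) _
            exact (hset ω).1 hm.1
      _ = P.real {ω | ∀ s, t ≤ s → s ≤ t + k → state ε x₀ ξ s ω ∈ closeSet n ρ} * (1 - q) := by
          rw [integral_indicator hAP, setIntegral_const, smul_eq_mul]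
      _ ≤ (1 - q) ^ k * (1 - q) := mul_le_mul_of_nonneg_right ih (by linarith)
      _ = (1 - q) ^ (k + 1) := (pow_succ _ _).symm

lemma reachesQuasiSyncInFiniteTime_of_tendsto {ε : ℝ} (hε : 0 < ε) (x₀ : Fin n → ℝ)
    (hnoise : ∀ t, ∀ᵐ ω ∂P, ∀ i j, ξ i (t + 1) ω - ξ j (t + 1) ω ≤ ε)
    (hlim : Tendsto (fun t => P.real {ω | state ε x₀ ξ t ω ∈ closeSet n ε}) atTop (nhds 1)) :
    ReachesQuasiSyncInFiniteTime P ε x₀ ξ := by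
  have hle : ∀ t, P.real {ω | state ε x₀ ξ t ω ∈ closeSet n ε} ≤
      P.real {ω | syncTime ε x₀ ξ ω < ⊤} := by
    intro t
    refine ENNReal.toReal_mono (measure_ne_top _ _) (measure_mono_ae ?_)
    filter_upwards [ae_all_iff.2 hnoise] with ω hω hmem
    have hstay : ∀ s, t ≤ s → state ε x₀ ξ s ω ∈ closeSet n ε := by
      intro s hs
      induction s, hs using Nat.le_induction with
      | base => exact hmem
      | succ s _ ih => exact step_mem_closeSet ih (hω s)
    exact lt_of_le_of_lt (iInf₂_le t fun s hs => (diameter_le_iff hε.le).2 (hstay s hs))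
      (ENat.natCast_lt_top t)
  have h1 : 1 ≤ P.real {ω | syncTime ε x₀ ξ ω < ⊤} := le_of_tendsto' hlim hle
  refine le_antisymm prob_le_one ?_
  rw [← ENNReal.ofReal_one]
  exact ENNReal.ofReal_le_of_le_toReal h1

lemma cannotReachQuasiSync_of_gt (hmeas : ∀ i t, Measurable (ξ i (t + 1)))
    (hindep : iIndepFun (fun p : Fin n × ℕ => ξ p.1 (p.2 + 1)) P)
    (hlaw : ∀ i t, P.map (ξ i (t + 1)) = μ) {ε ρ q : ℝ} (hε : 0 < ε) (x₀ : Fin n → ℝ)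
    (hρ : ε < ρ) (hq : 0 < q)
    (h : ∀ x : Fin n → ℝ,
      (Measure.pi fun _ : Fin n => μ).real {η | step ε x η ∈ closeSet n ρ} ≤ 1 - q) :
    CannotReachQuasiSync P ε x₀ ξ := by
  have hq1 : q ≤ 1 := by linarith [(measureReal_nonneg).trans (h x₀)]
  have hnull : ∀ t, P {ω | ∀ s, t ≤ s → state ε x₀ ξ s ω ∈ closeSet n ρ} = 0 := by
    intro t
    have hpow : Tendsto (fun k => (1 - q) ^ k) atTop (nhds 0) :=
      tendsto_pow_atTop_nhds_zero_of_lt_one (by linarith) (by linarith)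
    have hle : P.real {ω | ∀ s, t ≤ s → state ε x₀ ξ s ω ∈ closeSet n ρ} ≤ 0 :=
      ge_of_tendsto' hpow fun k => le_trans
        (measureReal_mono (Set.ofPred_subset_ofPred.2 fun ω hω s hs _ => hω s hs))
        (measureReal_forall_state_mem_closeSet_le hmeas hindep hlaw x₀ hq1 h t k)
    exact (measureReal_eq_zero_iff).1 (le_antisymm hle measureReal_nonneg)
  refine measure_mono_null (fun ω hω => ?_) (measure_iUnion_null hnull)
  have hlt : limsupDiameter ε x₀ ξ ω < (ρ : EReal) :=
    lt_of_le_of_lt hω (EReal.coe_lt_coe_iff.2 hρ)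
  obtain ⟨t, ht⟩ := eventually_atTop.1 (eventually_lt_of_limsup_lt hlt)
  refine Set.mem_iUnion.2 ⟨t, fun s hs => ?_⟩
  exact (diameter_le_iff (hε.le.trans hρ.le)).1 (EReal.coe_lt_coe_iff.1 (ht s hs)).le

end Chain

end HK

theorem theorem1 {Ω : Type*} [MeasurableSpace Ω] (P : Measure Ω) [IsProbabilityMeasure P]
    (n : ℕ) (hn : 0 < n)
    (ξ : Fin n → ℕ → Ω → ℝ)
    (hmeas : ∀ (i : Fin n) (t : ℕ), Measurable (ξ i (t + 1)))
    (hindep : iIndepFun (fun (p : Fin n × ℕ) => ξ p.1 (p.2 + 1)) P)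
    (hident : ∀ (i : Fin n) (t : ℕ), IdentDistrib (ξ i (t + 1)) (ξ ⟨0, hn⟩ 1) P P)
    (hnondeg : HK.NonDegenerate P (ξ ⟨0, hn⟩ 1))
    (x₀ : Fin n → ℝ) (ε : ℝ) (hε : 0 < ε) :
    ((∃ δ₁ δ₂ : ℝ, δ₂ - δ₁ = ε ∧ P {ω | δ₁ ≤ ξ ⟨0, hn⟩ 1 ω ∧ ξ ⟨0, hn⟩ 1 ω ≤ δ₂} = 1) →
      HK.ReachesQuasiSyncInFiniteTime P ε x₀ ξ) ∧
    (2 ≤ n →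
      (∀ δ₁ δ₂ : ℝ, δ₂ - δ₁ = ε → P {ω | δ₁ ≤ ξ ⟨0, hn⟩ 1 ω ∧ ξ ⟨0, hn⟩ 1 ω ≤ δ₂} < 1) →
      HK.CannotReachQuasiSync P ε x₀ ξ) := by
  set μ := P.map (ξ ⟨0, hn⟩ 1) with hμ
  have hm0 : Measurable (ξ ⟨0, hn⟩ 1) := hmeas _ 0
  have : IsProbabilityMeasure μ := Measure.isProbabilityMeasure_map hm0.aemeasurable
  have hlaw : ∀ i t, P.map (ξ i (t + 1)) = μ := fun i t => (hident i t).map_eq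
  have hIcc : ∀ δ₁ δ₂ : ℝ, μ (Set.Icc δ₁ δ₂) = P {ω | δ₁ ≤ ξ ⟨0, hn⟩ 1 ω ∧ ξ ⟨0, hn⟩ 1 ω ≤ δ₂} :=
    fun δ₁ δ₂ => Measure.map_apply hm0 measurableSet_Icc
  constructor
  · rintro ⟨δ₁, δ₂, hδ, hP⟩
    have hae : ∀ᵐ t ∂μ, t ∈ Set.Icc δ₁ δ₂ := by
      refine (mem_ae_iff_prob_eq_one measurableSet_Icc).2 ?_
      rw [hIcc, hP]
    -- the support of a non-degenerate law has two points
    obtain ⟨a, ha, b, hb, hab⟩ := HK.exists_mem_support_of_measure_Icc_lt μ (d := 0) fun c => by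
      refine lt_of_le_of_ne prob_le_one fun h1 => hnondeg ⟨c, ?_⟩
      have hc := ae_of_ae_map hm0.aemeasurable ((mem_ae_iff_prob_eq_one measurableSet_Icc).2 h1)
      filter_upwards [hc] with ω hω
      rw [add_zero] at hω
      exact le_antisymm hω.2 hω.1
    have hν := HK.ae_pi_sub_le hδ hae n
    refine HK.reachesQuasiSyncInFiniteTime_of_tendsto hε x₀ (fun t => ?_) ?_
    · rw [← HK.map_noise_eq_pi hmeas hindep hlaw t] at hν
      exact ae_of_ae_map (measurable_pi_lambda _ fun i => hmeas i t).aemeasurable hν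
    · simp only [HK.measureReal_state_mem_closeSet hmeas hindep hlaw]
      rw [← HK.limSyncProb_pi_eq_one hε hδ hae ha hb (by linarith) hn x₀]
      exact HK.tendsto_syncProb hν x₀
  · intro hn2 hP
    obtain ⟨a, ha, b, hb, hab⟩ := HK.exists_mem_support_of_measure_Icc_lt μ (d := ε) fun c => by
      rw [hIcc]
      exact hP c (c + ε) (by ring)
    obtain ⟨ρ, hρ, q, hq, h⟩ := HK.exists_real_step_mem_closeSet_le μ ha hb hab hn2
    exact HK.cannotReachQuasiSync_of_gt hmeas hindep hlaw hε x₀ hρ hq h
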